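/- Let $\mathbb S=\{z\in\mathbb R^3: z_1^2+z_2^2+z_3^2=1\}$ and $$Z_1=z_3\frac{\partial}{\partial z_2}-z_2\frac{\partial}{\partial z_3},\qquad Z_2=z_1\frac{\partial}{\partial z_3}-z_3\frac{\partial}{\partial z_1}.$$ For $z\in\mathbb S$ and $v$ in $H_z\mathbb S=\mathrm{span}\{Z_1|_z,Z_2|_z\}$ let $|v|_z=\inf\{\sqrt{a^2+b^2}: a,b\in\mathbb R,\ v=aZ_1|_z+bZ_2|_z\}$. The sub-Riemannian distance $\varrho(z,z')$ is the infimum of the lengths $\int_a^b|\gamma'(t)|_{\gamma(t)}\,dt$ over all absolutely continuous curves $\gamma:[a,b]\to\mathbb S$ joining $z$ to $z'$ such that $\gamma'(t)\in H_{\gamma(t)}\mathbb S$ for almost all $t$. Let $\varrho_R$ be the Riemannian distance on $\mathbb S$ induced by $\mathbb R^3$, and $\sigma$ the standard surface measure on $\mathbb S$. For $\theta\in[-\frac\pi2,\frac\pi2]$ and $\varphi\in\mathbb R/2\pi\mathbb Z$ put $$\lfloor\theta,\varphi\rceil=(\cos\theta\cos\varphi,\cos\theta\sin\varphi,\sin\theta),$$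 and let $|\varphi-\varphi'|$ denote the arclength distance on $\mathbb R/2\pi\mathbb Z$. For nonnegative quantities write $A\simeq B$ if there is a finite constant $C>0$ with $A\le CB$ and $B\le CA$; the constant is independent of all the variables, except where indicated. Then, for all $\theta,\theta'\in[-\frac\pi2,\frac\pi2]$ and $\varphi,\varphi'\in\mathbb R/2\pi\mathbb Z$: 1. $$\varrho(\lfloor\theta,\varphi\rceil,\lfloor\theta',\varphi'\rceil)\simeq|\theta-\theta'|+\min\left\{|\varphi-\varphi'|^{1/2},\frac{|\varphi-\varphi'|}{\max\{|\tan\theta|,|\tan\theta'|\}}\right\},$$ where $|\tan(\pm\frac\pi2)|=\infty$; the quotient is $0$ if the maximum is $\infty$, and the minimum is $|\varphi-\varphi'|^{1/2}$ if the maximum is $0$. 2. In particular, $\varrho(\lfloor0,\varphi\rceil,\lfloor0,\varphi'\rceil)\simeq|\varphi-\varphi'|^{1/2}$. 3. For every $\varepsilon>0$, if $\max\{|\theta|,|\theta'|\}\ge\varepsilon$, then $\varrho(\lfloor\theta,\varphi\rceil,\lfloor\theta',\varphi'\rceil)\simeq\varrho_R(\lfloor\theta,\varphi\rceil,\lfloor\theta',\varphi'\rceil)$,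 where the implicit constant may depend on $\varepsilon$ only. 4. For every $r\ge0$, the $\sigma$-measure $V(\lfloor\theta,\varphi\rceil,r)$ of the open $\varrho$-ball with centre $\lfloor\theta,\varphi\rceil$ and radius $r$ satisfies $$V(\lfloor\theta,\varphi\rceil,r)\simeq\min\{1,r^2\max\{r,|\theta|\}\}.$$ -/

import Mathlib

open Set MeasureTheory
open scoped ENNReal NNReal

noncomputable section

namespace GrushinSphere

/-- The ambient Euclidean space `ℝ³`; the coordinates `z₁, z₂, z₃` are `z 0, z 1, z 2`. -/
abbrev R3 : Type := EuclideanSpace ℝ (Fin 3)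

/-- The unit sphere in `ℝ³`. -/
abbrev S2 : Type := Metric.sphere (0 : R3) 1

/-- `Z₁ = z₃ ∂/∂z₂ - z₂ ∂/∂z₃`. -/
def Z₁ (z : R3) : R3 := !₂[0, z 2, -z 1]

/-- `Z₂ = z₁ ∂/∂z₃ - z₃ ∂/∂z₁`. -/
def Z₂ (z : R3) : R3 := !₂[-z 2, 0, z 0]

/-- The horizontal distribution `H_z = span {Z₁|_z, Z₂|_z}`. -/
def horizontalSpace (z : R3) : Submodule ℝ R3 := Submodule.span ℝ {Z₁ z, Z₂ z}

/-- The norm `|v|_z = inf {√(a² + b²) : v = a Z₁|_z + b Z₂|_z}` (infinite if `v` is not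
horizontal at `z`). -/
def horizontalNorm (z v : R3) : ℝ≥0∞ :=
  ⨅ (a : ℝ) (b : ℝ) (_ : v = a • Z₁ z + b • Z₂ z), ENNReal.ofReal (Real.sqrt (a ^ 2 + b ^ 2))

/-- `γ`, restricted to `[a, b]`, is an absolutely continuous curve on the sphere which joins
`z` to `z'`. -/
structure IsCurveJoining (γ : ℝ → R3) (a b : ℝ) (z z' : S2) : Prop where
  le : a ≤ b
  absCont : AbsolutelyContinuousOnInterval γ a b
  mem_sphere : ∀ t ∈ Icc a b, γ t ∈ Metric.sphere (0 : R3) 1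
  left : γ a = z
  right : γ b = z'

/-- The derivative of the curve `γ` is horizontal almost everywhere on `[a, b]`. -/
def IsHorizontal (γ : ℝ → R3) (a b : ℝ) : Prop :=
  ∀ᵐ t ∂(volume.restrict (Icc a b)), deriv γ t ∈ horizontalSpace (γ t)

/-- The sub-Riemannian length of a horizontal curve. -/
def horizontalLength (γ : ℝ → R3) (a b : ℝ) : ℝ≥0∞ :=
  ∫⁻ t in Icc a b, horizontalNorm (γ t) (deriv γ t)

/-- The sub-Riemannian distance: the infimum of the lengths of all horizontal curves on the
sphere joining `z` to `z'`. -/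
def subRiemannianDist (z z' : S2) : ℝ≥0∞ :=
  ⨅ (γ : ℝ → R3) (a : ℝ) (b : ℝ) (_ : IsCurveJoining γ a b z z') (_ : IsHorizontal γ a b),
    horizontalLength γ a b

/-- The Riemannian distance of the round metric: the infimum of the Euclidean lengths of all
absolutely continuous curves on the sphere joining `z` to `z'`. -/
def riemannianDist (z z' : S2) : ℝ≥0∞ :=
  ⨅ (γ : ℝ → R3) (a : ℝ) (b : ℝ) (_ : IsCurveJoining γ a b z z'),
    ∫⁻ t in Icc a b, ‖deriv γ t‖ₑ

/-- The standard rotation-invariant (surface) measure on the sphere, of total mass `4π`. -/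
def surfaceMeasure : Measure S2 := (volume : Measure R3).toSphere

/-- The surface measure of the sub-Riemannian ball with centre `z` and radius `r`. -/
def ballVolume (z : S2) (r : ℝ) : ℝ≥0∞ :=
  surfaceMeasure {w : S2 | subRiemannianDist z w < ENNReal.ofReal r}

/-- The point `(cos θ cos φ, cos θ sin φ, sin θ)` of the sphere; here `φ ∈ ℝ/2πℤ`. -/
def point (θ : ℝ) (φ : Real.Angle) : S2 :=
  ⟨!₂[Real.cos θ * φ.cos, Real.cos θ * φ.sin, Real.sin θ], by
    rw [mem_sphere_zero_iff_norm, EuclideanSpace.norm_eq, Real.sqrt_eq_one]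
    simp only [Fin.sum_univ_three, Real.norm_eq_abs, sq_abs]
    have h1 := φ.cos_sq_add_sin_sq
    have h2 := Real.sin_sq_add_cos_sq θ
    simp
    linear_combination (Real.cos θ) ^ 2 * h1 + h2⟩

/-- `|tan θ|` as an extended real; it is infinite when `cos θ = 0`. -/
def absTan (θ : ℝ) : ℝ≥0∞ := ENNReal.ofReal |Real.sin θ| / ENNReal.ofReal |Real.cos θ|

/-- `|θ - θ'| + min {|φ - φ'|^(1/2), |φ - φ'| / max {|tan θ|, |tan θ'|}}`, where `|φ - φ'|` is the
arclength distance on `ℝ/2πℤ`. In `[0, ∞]` the quotient is infinite if `θ = θ' = 0` and `φ ≠ φ'`,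
and it vanishes if `θ` or `θ'` is `±π/2`. -/
def model (θ : ℝ) (φ : Real.Angle) (θ' : ℝ) (φ' : Real.Angle) : ℝ≥0∞ :=
  ENNReal.ofReal |θ - θ'| +
    min (ENNReal.ofReal (dist φ φ') ^ (1 / 2 : ℝ))
      (ENNReal.ofReal (dist φ φ') / max (absTan θ) (absTan θ'))

/-- `A` and `B` are comparable with the constant `C`: `A ≤ C B` and `B ≤ C A`. -/
def Comparable (C : ℝ≥0) (A B : ℝ≥0∞) : Prop := A ≤ C * B ∧ B ≤ C * A

end GrushinSphere

end

/-! In latitude and longitude the horizontal frame is orthogonally equivalent, away from the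
equator, to the unit meridian field and `tan θ` times the unit field along parallels. So meridians
cost their Euclidean length, and travelling a longitude `d` along the parallel `η` costs `d * |cot
η|`.

Upper bound: join two points by meridian, parallel, meridian. The parallel is either the higher of
the two latitudes or, when both points are too close to the equator for this to be cheap, the
latitude `arctan √d`, where the parallel costs exactly `√d`.

Lower bound: a horizontal curve is at least as long as its Euclidean length, hence at least the
chord. Moreover its projection to the first two coordinates moves at speed at most `|z₃|` times the
horizontal speed, and a curve of length less than `r` stays at height at most `r + |z₃|` of its
starting point; so the projection is displaced by at most `r * (r + |z₃|)`. The two facts together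
control the model (`gap_le`). Away from the equator the model is bounded by the chord, and chord ≤
Riemannian ≤ sub-Riemannian closes the circle.

Volumes: in an orthonormal frame at the centre, balls of radius `r ≤ 1` are comparable to patches
with sides `r * max r |θ|` (longitude) and `r` (latitude). The surface measure of a patch is read
off from the cone over it, which is compared with boxes in `ℝ³`. -/

noncomputable section

/-! ### Displacement of absolutely continuous curves -/

namespace AbsolutelyContinuousOnInterval

variable {E : Type*} [NormedAddCommGroup E] [NormedSpace ℝ E] {f : ℝ → E} {a b : ℝ}

theorem clm_comp (ℓ : E →L[ℝ] ℝ) (hf : AbsolutelyContinuousOnInterval f a b) :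
    AbsolutelyContinuousOnInterval (fun t => ℓ (f t)) a b := by
  apply squeeze_zero (fun t ↦ ?_) (fun t ↦ ?_)
    (by simpa using Filter.Tendsto.const_mul ‖ℓ‖ hf)
  · exact Finset.sum_nonneg fun i _ ↦ dist_nonneg
  · rw [Finset.mul_sum]
    gcongr
    exact ℓ.dist_le_opNorm _ _

/-- The scalar function `ℓ ∘ f` is the integral of its derivative. Finite dimension makes `f` itself
differentiable almost everywhere, so that `ℓ` can be pulled out of the derivative. -/
theorem enorm_clm_sub_le [FiniteDimensional ℝ E] (ℓ : E →L[ℝ] ℝ)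
    (hf : AbsolutelyContinuousOnInterval f a b) (hab : a ≤ b) :
    ‖ℓ (f b) - ℓ (f a)‖ₑ ≤ ∫⁻ t in Icc a b, ‖ℓ (deriv f t)‖ₑ := by
  have hderiv : ∀ᵐ t ∂(volume.restrict (Ioc a b)),
      ‖deriv (fun t => ℓ (f t)) t‖ₑ = ‖ℓ (deriv f t)‖ₑ := by
    rw [ae_restrict_iff' measurableSet_Ioc]
    filter_upwards [hf.boundedVariationOn.ae_differentiableAt_of_mem_uIcc] with t ht hmem
    have hd := ht (by rw [uIcc_of_le hab]; exact Ioc_subset_Icc_self hmem)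
    have hcomp : deriv (fun t => ℓ (f t)) t = ℓ (deriv f t) :=
      ((ℓ.hasFDerivAt (x := f t)).comp_hasDerivAt t hd.hasDerivAt).deriv
    rw [hcomp]
  rw [← (hf.clm_comp ℓ).integral_deriv_eq_sub, intervalIntegral.integral_of_le hab]
  calc _ ≤ ∫⁻ t in Ioc a b, ‖deriv (fun t => ℓ (f t)) t‖ₑ := enorm_integral_le_lintegral_enorm _
    _ = ∫⁻ t in Ioc a b, ‖ℓ (deriv f t)‖ₑ := lintegral_congr_ae hderiv
    _ ≤ _ := lintegral_mono_set Ioc_subset_Icc_self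

theorem enorm_sub_le [FiniteDimensional ℝ E]
    (hf : AbsolutelyContinuousOnInterval f a b) (hab : a ≤ b) :
    ‖f b - f a‖ₑ ≤ ∫⁻ t in Icc a b, ‖deriv f t‖ₑ := by
  obtain ⟨g, hg, hgx⟩ := exists_dual_vector'' ℝ (f b - f a)
  have h := hf.enorm_clm_sub_le g hab
  rw [← map_sub, hgx] at h
  calc ‖f b - f a‖ₑ = ‖((‖f b - f a‖ : ℝ))‖ₑ := (enorm_norm _).symm
    _ ≤ _ := h
    _ ≤ _ := lintegral_mono fun t => by
      have := g.le_of_opNorm_le hg (deriv f t)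
      rw [one_mul] at this
      exact enorm_le_iff_norm_le.2 this

end AbsolutelyContinuousOnInterval

/-! ### Lower bounds for lengths of horizontal curves -/

namespace GrushinSphere

theorem ofReal_le_mul_horizontalNorm {z v : R3} {x K : ℝ} (hK : 0 < K)
    (h : ∀ a b : ℝ, v = a • Z₁ z + b • Z₂ z → x ≤ K * Real.sqrt (a ^ 2 + b ^ 2)) :
    ENNReal.ofReal x ≤ ENNReal.ofReal K * horizontalNorm z v := by
  rw [mul_comm, ← ENNReal.div_le_iff_le_mul (Or.inl (by simpa using hK)) (Or.inl ENNReal.ofReal_ne_top),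
    ← ENNReal.ofReal_div_of_pos hK]
  refine le_iInf fun a => le_iInf fun b => le_iInf fun hv => ENNReal.ofReal_le_ofReal ?_
  rw [div_le_iff₀' hK]
  exact h a b hv

theorem sum_sq_eq_one_of_mem_sphere {z : R3} (hz : z ∈ Metric.sphere (0 : R3) 1) :
    z 0 ^ 2 + z 1 ^ 2 + z 2 ^ 2 = 1 := by
  rw [mem_sphere_zero_iff_norm, EuclideanSpace.norm_eq, Real.sqrt_eq_one] at hz
  simpa [Fin.sum_univ_three] using hz

theorem norm_sq_eq (v : R3) : ‖v‖ ^ 2 = v 0 ^ 2 + v 1 ^ 2 + v 2 ^ 2 := by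
  rw [EuclideanSpace.norm_sq_eq]
  simp [Fin.sum_univ_three]

/-- On the sphere the squared norm equals `a² + b² - (a z₁ + b z₂)²`. -/
theorem norm_le_sqrt_of_mem_sphere {z : R3} (hz : z ∈ Metric.sphere (0 : R3) 1) (a b : ℝ) :
    ‖a • Z₁ z + b • Z₂ z‖ ≤ Real.sqrt (a ^ 2 + b ^ 2) := by
  refine Real.le_sqrt_of_sq_le ?_
  have h := sum_sq_eq_one_of_mem_sphere hz
  rw [norm_sq_eq]
  simp [Z₁, Z₂]
  nlinarith [sq_nonneg (a * z 0 + b * z 1)]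

theorem enorm_le_horizontalNorm {z : R3} (hz : z ∈ Metric.sphere (0 : R3) 1) (v : R3) :
    ‖v‖ₑ ≤ horizontalNorm z v := by
  have := ofReal_le_mul_horizontalNorm (z := z) (v := v) (x := ‖v‖) one_pos
    (fun a b hv => by rw [hv, one_mul]; exact norm_le_sqrt_of_mem_sphere hz a b)
  simpa using this

theorem riemannianDist_le_subRiemannianDist (z w : S2) :
    riemannianDist z w ≤ subRiemannianDist z w := by
  refine le_iInf fun γ => le_iInf fun a => le_iInf fun b => le_iInf fun h => le_iInf fun _ => ?_
  refine (iInf₂_le_of_le γ a (iInf₂_le b h)).trans ?_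
  refine setLIntegral_mono' measurableSet_Icc fun t ht => ?_
  exact enorm_le_horizontalNorm (h.mem_sphere t ht) _

theorem enorm_sub_le_riemannianDist (z w : S2) :
    ‖(w : R3) - z‖ₑ ≤ riemannianDist z w := by
  refine le_iInf fun γ => le_iInf fun a => le_iInf fun b => le_iInf fun h => ?_
  rw [← h.left, ← h.right]
  exact h.absCont.enorm_sub_le h.le

theorem norm_sub_le_of_subRiemannianDist_lt {z w : S2} {r : ℝ}
    (h : subRiemannianDist z w < ENNReal.ofReal r) : ‖(w : R3) - z‖ ≤ r := by
  have hr : 0 < r := by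
    by_contra hr
    rw [ENNReal.ofReal_of_nonpos (not_lt.1 hr)] at h
    exact not_lt_bot h
  have := ((enorm_sub_le_riemannianDist z w).trans
    (riemannianDist_le_subRiemannianDist z w)).trans h.le
  rw [← ofReal_norm] at this
  exact (ENNReal.ofReal_le_ofReal_iff hr.le).1 this

/-- The horizontal components of a point move slowly along horizontal curves near the equator. -/
theorem abs_horizontal_component_le {z w : S2} {r : ℝ}
    (h : subRiemannianDist z w < ENNReal.ofReal r) {p q : ℝ} (hpq : p ^ 2 + q ^ 2 = 1) :
    |p * ((w : R3) 0 - (z : R3) 0) + q * ((w : R3) 1 - (z : R3) 1)|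
      ≤ r * (r + |(z : R3) 2|) := by
  have hr : 0 < r := by
    by_contra hr
    rw [ENNReal.ofReal_of_nonpos (not_lt.1 hr)] at h
    exact not_lt_bot h
  have h' := h
  simp only [subRiemannianDist, iInf_lt_iff] at h'
  obtain ⟨γ, a, b, hγ, -, hlen⟩ := h'
  set K : ℝ := r + |(z : R3) 2| with hK
  have hK0 : 0 < K := by positivity
  -- The initial arc up to `t` is no longer than the whole curve, so the height changes by at most
  -- `r`.
  have hheight : ∀ t ∈ Icc a b, |γ t 2| ≤ K := by
    intro t ht
    have hac : AbsolutelyContinuousOnInterval γ a t := hγ.absCont.mono (by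
      rw [uIcc_of_le ht.1, uIcc_of_le hγ.le]; exact Icc_subset_Icc_right ht.2)
    have h1 : ‖γ t - γ a‖ₑ ≤ ENNReal.ofReal r := by
      refine (hac.enorm_sub_le ht.1).trans (le_trans ?_ hlen.le)
      refine (lintegral_mono_set (Icc_subset_Icc_right ht.2)).trans ?_
      exact setLIntegral_mono' measurableSet_Icc fun s hs =>
        enorm_le_horizontalNorm (hγ.mem_sphere s hs) _
    rw [← ofReal_norm, ENNReal.ofReal_le_ofReal_iff hr.le] at h1
    have h2 := (PiLp.norm_apply_le (γ t - γ a) 2).trans h1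
    rw [PiLp.sub_apply, Real.norm_eq_abs, hγ.left] at h2
    have := abs_sub_abs_le_abs_sub (γ t 2) ((z : R3) 2)
    linarith
  let ℓ : R3 →L[ℝ] ℝ := p • EuclideanSpace.proj 0 + q • EuclideanSpace.proj 1
  have hℓ : ∀ v : R3, ℓ v = p * v 0 + q * v 1 := fun v => by simp [ℓ]
  have h1 : ‖ℓ (γ b) - ℓ (γ a)‖ₑ ≤ ENNReal.ofReal K * ENNReal.ofReal r := by
    refine (hγ.absCont.enorm_clm_sub_le ℓ hγ.le).trans ?_
    refine le_trans ?_ (mul_le_mul_right hlen.le _)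
    rw [horizontalLength, ← lintegral_const_mul' _ _ ENNReal.ofReal_ne_top]
    refine setLIntegral_mono' measurableSet_Icc fun s hs => ?_
    rw [← ofReal_norm]
    refine ofReal_le_mul_horizontalNorm hK0 fun c d hv => ?_
    rw [hv, hℓ, Real.norm_eq_abs]
    -- The first two coordinates of `c Z₁ + d Z₂` are `z₃ (-d, c)`: the factor `z₃` is the
    -- degeneracy at the equator.
    have : p * (c • Z₁ (γ s) + d • Z₂ (γ s)) 0 + q * (c • Z₁ (γ s) + d • Z₂ (γ s)) 1
        = γ s 2 * (q * c - p * d) := by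
      simp [Z₁, Z₂]; ring
    rw [this, abs_mul]
    refine mul_le_mul (hheight s hs) ?_ (abs_nonneg _) hK0.le
    refine Real.abs_le_sqrt ?_
    nlinarith [sq_nonneg (p * c + q * d)]
  rw [← ENNReal.ofReal_mul hK0.le, ← ofReal_norm, ENNReal.ofReal_le_ofReal_iff (by positivity),
    hℓ, hℓ, hγ.left, hγ.right, Real.norm_eq_abs] at h1
  calc _ = |p * (w : R3) 0 + q * (w : R3) 1 - (p * (z : R3) 0 + q * (z : R3) 1)| := by
        congr 1; ring
    _ ≤ _ := h1
    _ = _ := mul_comm _ _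

/-! ### Explicit horizontal curves -/

/-- Latitude and longitude coordinates, with a real longitude. -/
def chart (θ x : ℝ) : R3 :=
  !₂[Real.cos θ * Real.cos x, Real.cos θ * Real.sin x, Real.sin θ]

theorem coe_point (θ x : ℝ) : (point θ (x : Real.Angle) : R3) = chart θ x := by
  simp [point, chart]

theorem chart_mem_sphere (θ x : ℝ) : chart θ x ∈ Metric.sphere (0 : R3) 1 :=
  coe_point θ x ▸ (point θ (x : Real.Angle)).2

theorem norm_chart_sub_sq (θ x θ' x' : ℝ) :
    ‖chart θ x - chart θ' x'‖ ^ 2 = 2 * (1 - Real.cos (θ - θ')) +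
      2 * (Real.cos θ * Real.cos θ') * (1 - Real.cos (x - x')) := by
  rw [norm_sq_eq, Real.cos_sub, Real.cos_sub]
  simp [chart]
  linear_combination (Real.cos θ) ^ 2 * Real.sin_sq_add_cos_sq x +
    (Real.cos θ') ^ 2 * Real.sin_sq_add_cos_sq x' + Real.sin_sq_add_cos_sq θ +
    Real.sin_sq_add_cos_sq θ'

theorem norm_chart_sub_le (θ x θ' x' : ℝ) :
    ‖chart θ x - chart θ' x'‖ ≤ |θ - θ'| + |x - x'| := by
  refine abs_le_of_sq_le_sq' ?_ (by positivity) |>.2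
  rw [norm_chart_sub_sq]
  have h1 := Real.one_sub_sq_div_two_le_cos (x := θ - θ')
  have h2 := Real.one_sub_sq_div_two_le_cos (x := x - x')
  have h3 : Real.cos θ * Real.cos θ' ≤ 1 := by
    nlinarith [sq_nonneg (Real.cos θ - Real.cos θ'), Real.cos_sq_le_one θ, Real.cos_sq_le_one θ']
  have h4 : (Real.cos θ * Real.cos θ') * (1 - Real.cos (x - x')) ≤ 1 * (1 - Real.cos (x - x')) :=
    mul_le_mul_of_nonneg_right h3 (by linarith [Real.cos_le_one (x - x')])
  nlinarith [sq_abs (θ - θ'), sq_abs (x - x'), abs_nonneg (θ - θ'), abs_nonneg (x - x'),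
    mul_nonneg (abs_nonneg (θ - θ')) (abs_nonneg (x - x'))]

/-- At `chart θ x`, the field `-sin x Z₁ + cos x Z₂` is the unit meridian direction, and `cos x Z₁ +
sin x Z₂` is `sin θ` times the unit direction of the parallel. The coefficients are a rotation of
`(β, κ)`. If `ν = 0`, then `κ = 0` even where `sin θ = 0`. -/
theorem hasDerivAt_chart (α β μ ν t : ℝ) (h : ν = 0 ∨ Real.sin (α + β * t) ≠ 0) :
    ∃ a b : ℝ, HasDerivAt (fun t => chart (α + β * t) (μ + ν * t))
        (a • Z₁ (chart (α + β * t) (μ + ν * t)) + b • Z₂ (chart (α + β * t) (μ + ν * t))) t ∧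
      Real.sqrt (a ^ 2 + b ^ 2) ≤
        |β| + |ν * (Real.cos (α + β * t) / Real.sin (α + β * t))| := by
  set θ := α + β * t with hθ
  set x := μ + ν * t with hx
  set κ := ν * (Real.cos θ / Real.sin θ) with hκ
  have hκs : κ * Real.sin θ = ν * Real.cos θ := by
    rcases h with h | h
    · simp [hκ, h]
    · rw [hκ]; field_simp
  have hdθ : HasDerivAt (fun t => α + β * t) β t := by
    simpa using ((hasDerivAt_id t).const_mul β).const_add α
  have hdx : HasDerivAt (fun t => μ + ν * t) ν t := by
    simpa using ((hasDerivAt_id t).const_mul ν).const_add μ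
  refine ⟨-β * Real.sin x + κ * Real.cos x, β * Real.cos x + κ * Real.sin x, ?_, ?_⟩
  · have hpi : HasDerivAt (fun t => ![Real.cos (α + β * t) * Real.cos (μ + ν * t),
        Real.cos (α + β * t) * Real.sin (μ + ν * t), Real.sin (α + β * t)])
        ![-Real.sin θ * β * Real.cos x + Real.cos θ * (-Real.sin x * ν),
          -Real.sin θ * β * Real.sin x + Real.cos θ * (Real.cos x * ν), Real.cos θ * β] t := by
      refine hasDerivAt_pi.2 fun i => ?_
      fin_cases i
      · exact hdθ.cos.mul hdx.cos
      · exact hdθ.cos.mul hdx.sin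
      · exact hdθ.sin
    have hd := ((PiLp.continuousLinearEquiv 2 ℝ
      (fun _ : Fin 3 => ℝ)).symm.hasFDerivAt).comp_hasDerivAt t hpi
    refine HasDerivAt.congr_deriv (f := fun t => chart (α + β * t) (μ + ν * t)) hd ?_
    have hcs := Real.sin_sq_add_cos_sq x
    ext i
    fin_cases i
    · simp [Z₁, Z₂, chart]
      linear_combination Real.sin x * hκs
    · simp [Z₁, Z₂, chart]
      linear_combination -Real.cos x * hκs
    · simp [Z₁, Z₂, chart]
      linear_combination -Real.cos θ * β * hcs
  · refine Real.sqrt_le_iff.2 ⟨by positivity, ?_⟩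
    have := Real.sin_sq_add_cos_sq x
    have e : (-β * Real.sin x + κ * Real.cos x) ^ 2 + (β * Real.cos x + κ * Real.sin x) ^ 2
        = |β| ^ 2 + |κ| ^ 2 := by
      rw [sq_abs, sq_abs]; linear_combination (β ^ 2 + κ ^ 2) * this
    rw [e]
    nlinarith [mul_nonneg (abs_nonneg β) (abs_nonneg κ)]

theorem horizontal_of_eqOn_chart {γ : ℝ → R3} {s s' α β μ ν M t : ℝ}
    (hγ : ∀ t ∈ Ioo s s', γ t = chart (α + β * t) (μ + ν * t)) (ht : t ∈ Ioo s s')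
    (h : ν = 0 ∨ Real.sin (α + β * t) ≠ 0)
    (hM : |β| + |ν * (Real.cos (α + β * t) / Real.sin (α + β * t))| ≤ M) :
    deriv γ t ∈ horizontalSpace (γ t) ∧ horizontalNorm (γ t) (deriv γ t) ≤ ENNReal.ofReal M := by
  obtain ⟨a, b, hd, hab⟩ := hasDerivAt_chart α β μ ν t h
  have heq : γ =ᶠ[nhds t] fun t => chart (α + β * t) (μ + ν * t) :=
    Filter.eventuallyEq_of_mem (Ioo_mem_nhds ht.1 ht.2) hγ
  have hd' : deriv γ t = a • Z₁ (γ t) + b • Z₂ (γ t) := by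
    rw [heq.deriv_eq, hd.deriv, hγ t ht]
  constructor
  · rw [hd']
    exact add_mem (Submodule.smul_mem _ _ (Submodule.subset_span (by simp)))
      (Submodule.smul_mem _ _ (Submodule.subset_span (by simp)))
  · exact (iInf₂_le_of_le a b (iInf_le _ hd')).trans (ENNReal.ofReal_le_ofReal (hab.trans hM))

/-- Truncation to the unit interval. -/
def clamp (t : ℝ) : ℝ := max 0 (min t 1)

theorem abs_clamp_sub_clamp_le (s t : ℝ) : |clamp s - clamp t| ≤ |s - t| := by
  unfold clamp
  grind

/-- Move along a meridian to the latitude `η`, then along this parallel, then along a meridian. -/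
theorem subRiemannianDist_chart_le (θ θ' η x y : ℝ) (h : y = 0 ∨ Real.sin η ≠ 0) :
    subRiemannianDist (point θ (x : Real.Angle)) (point θ' ((x + y : ℝ) : Real.Angle)) ≤
      ENNReal.ofReal (|η - θ| + |y * (Real.cos η / Real.sin η)| + |θ' - η|) := by
  -- Each shifted `clamp` varies on one unit interval only, so a single Lipschitz formula on `[0,
  -- 3]` describes the three legs.
  set Θ : ℝ → ℝ := fun t => θ + (η - θ) * clamp t + (θ' - η) * clamp (t - 2) with hΘ
  set X : ℝ → ℝ := fun t => x + y * clamp (t - 1) with hX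
  set γ : ℝ → R3 := fun t => chart (Θ t) (X t) with hγ
  have hlip : ∀ s t, dist (γ s) (γ t) ≤ (|η - θ| + |θ' - η| + |y|) * dist s t := by
    intro s t
    rw [dist_eq_norm, Real.dist_eq]
    refine (norm_chart_sub_le _ _ _ _).trans ?_
    have e1 : Θ s - Θ t = (η - θ) * (clamp s - clamp t) +
      (θ' - η) * (clamp (s - 2) - clamp (t - 2)) := by simp only [hΘ]; ring
    have e2 : X s - X t = y * (clamp (s - 1) - clamp (t - 1)) := by simp only [hX]; ring
    have c0 := abs_clamp_sub_clamp_le s t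
    have c1 := abs_clamp_sub_clamp_le (s - 1) (t - 1)
    have c2 := abs_clamp_sub_clamp_le (s - 2) (t - 2)
    rw [sub_sub_sub_cancel_right] at c1 c2
    have a1 := abs_add_le ((η - θ) * (clamp s - clamp t))
      ((θ' - η) * (clamp (s - 2) - clamp (t - 2)))
    rw [e1, e2]
    rw [abs_mul, abs_mul] at a1
    rw [abs_mul y]
    have b0 := mul_le_mul_of_nonneg_left c0 (abs_nonneg (η - θ))
    have b1 := mul_le_mul_of_nonneg_left c1 (abs_nonneg y)
    have b2 := mul_le_mul_of_nonneg_left c2 (abs_nonneg (θ' - η))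
    linarith
  have hcurve : IsCurveJoining γ 0 3 (point θ (x : Real.Angle))
      (point θ' ((x + y : ℝ) : Real.Angle)) := by
    refine ⟨by norm_num, ?_, fun t _ => chart_mem_sphere _ _, ?_, ?_⟩
    · refine LipschitzOnWith.absolutelyContinuousOnInterval
        (K := Real.toNNReal (|η - θ| + |θ' - η| + |y|)) ?_
      refine LipschitzOnWith.of_dist_le_mul fun s _ t _ => ?_
      rw [Real.coe_toNNReal _ (by positivity)]
      exact hlip s t
    · rw [coe_point]
      simp only [hγ, hΘ, hX, clamp]
      norm_num
    · rw [coe_point]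
      simp only [hγ, hΘ, hX, clamp]
      norm_num
  have p1 : ∀ t ∈ Ioo (0 : ℝ) 1, deriv γ t ∈ horizontalSpace (γ t) ∧
      horizontalNorm (γ t) (deriv γ t) ≤ ENNReal.ofReal |η - θ| := by
    intro t ht
    refine horizontal_of_eqOn_chart (s := 0) (s' := 1) (α := θ) (β := η - θ) (μ := x) (ν := 0)
      (fun t ht => ?_) ht (Or.inl rfl) (by simp)
    have c0 : clamp t = t := by unfold clamp; grind
    have c1 : clamp (t - 1) = 0 := by unfold clamp; grind
    have c2 : clamp (t - 2) = 0 := by unfold clamp; grind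
    simp [hγ, hΘ, hX, c0, c1, c2]
  have p2 : ∀ t ∈ Ioo (1 : ℝ) 2, deriv γ t ∈ horizontalSpace (γ t) ∧
      horizontalNorm (γ t) (deriv γ t) ≤
        ENNReal.ofReal |y * (Real.cos η / Real.sin η)| := by
    intro t ht
    refine horizontal_of_eqOn_chart (s := 1) (s' := 2) (α := η) (β := 0) (μ := x - y) (ν := y)
      (fun t ht => ?_) ht (by simpa using h) (by simp)
    have c0 : clamp t = 1 := by unfold clamp; grind
    have c1 : clamp (t - 1) = t - 1 := by unfold clamp; grind
    have c2 : clamp (t - 2) = 0 := by unfold clamp; grind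
    simp only [hγ, hΘ, hX, c0, c1, c2]
    congr 1 <;> ring
  have p3 : ∀ t ∈ Ioo (2 : ℝ) 3, deriv γ t ∈ horizontalSpace (γ t) ∧
      horizontalNorm (γ t) (deriv γ t) ≤ ENNReal.ofReal |θ' - η| := by
    intro t ht
    refine horizontal_of_eqOn_chart (s := 2) (s' := 3) (α := η - 2 * (θ' - η)) (β := θ' - η)
      (μ := x + y) (ν := 0) (fun t ht => ?_) ht (Or.inl rfl) (by simp)
    have c0 : clamp t = 1 := by unfold clamp; grind
    have c1 : clamp (t - 1) = 1 := by unfold clamp; grind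
    have c2 : clamp (t - 2) = t - 2 := by unfold clamp; grind
    simp only [hγ, hΘ, hX, c0, c1, c2]
    congr 1 <;> ring
  have hhor : IsHorizontal γ 0 3 := by
    rw [IsHorizontal, ae_restrict_iff' measurableSet_Icc]
    -- The finitely many junction times, where the curve may have corners, are discarded.
    filter_upwards [(Set.toFinite ({0, 1, 2, 3} : Set ℝ)).countable.ae_notMem volume] with t ht hI
    simp only [mem_insert_iff, mem_singleton_iff, not_or] at ht
    obtain ⟨n0, n1, n2, n3⟩ := ht
    rcases lt_or_ge t 1 with h1 | h1
    · exact (p1 t ⟨lt_of_le_of_ne hI.1 (Ne.symm n0), h1⟩).1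
    rcases lt_or_ge t 2 with h2 | h2
    · exact (p2 t ⟨lt_of_le_of_ne h1 (Ne.symm n1), h2⟩).1
    · exact (p3 t ⟨lt_of_le_of_ne h2 (Ne.symm n2), lt_of_le_of_ne hI.2 n3⟩).1
  have key : ∀ (s M : ℝ), (∀ t ∈ Ioo s (s + 1), horizontalNorm (γ t) (deriv γ t) ≤
      ENNReal.ofReal M) →
      ∫⁻ t in Icc s (s + 1), horizontalNorm (γ t) (deriv γ t) ≤ ENNReal.ofReal M := by
    intro s M hM
    rw [setLIntegral_congr Ioo_ae_eq_Icc.symm]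
    calc _ ≤ ∫⁻ _ in Ioo s (s + 1), ENNReal.ofReal M := setLIntegral_mono' measurableSet_Ioo hM
      _ = _ := by simp
  refine (iInf₂_le_of_le γ 0 (iInf_le_of_le 3 (iInf₂_le_of_le hcurve hhor le_rfl))).trans ?_
  rw [horizontalLength, ENNReal.ofReal_add (by positivity) (by positivity),
    ENNReal.ofReal_add (by positivity) (by positivity)]
  have hsub : Icc (0 : ℝ) 3 ⊆ (Icc 0 1 ∪ Icc 1 2) ∪ Icc 2 3 := by
    intro t ht
    simp only [mem_union, mem_Icc] at *
    grind
  refine (lintegral_mono_set hsub).trans ((lintegral_union_le _ _ _).trans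
    (add_le_add ((lintegral_union_le _ _ _).trans (add_le_add ?_ ?_)) ?_))
  · have := key 0 _ (by norm_num; exact fun t h0 h1 => (p1 t ⟨h0, h1⟩).2)
    norm_num at this; exact this
  · have := key 1 _ (by rw [one_add_one_eq_two]; exact fun t h => (p2 t h).2)
    rwa [one_add_one_eq_two] at this
  · have := key 2 _ (by norm_num; exact fun t h0 h1 => (p3 t ⟨h0, h1⟩).2)
    norm_num at this; exact this

/-! ### Chords in terms of latitude and longitude -/

theorem dist_eq_abs_toReal (φ φ' : Real.Angle) : dist φ φ' = |(φ' - φ).toReal| := by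
  rw [dist_comm, dist_eq_norm]
  conv_lhs => rw [← Real.Angle.coe_toReal (φ' - φ)]
  have h : (2 * Real.pi) ≠ 0 := by positivity
  refine (AddCircle.norm_coe_eq_abs_iff (p := 2 * Real.pi) (x := (φ' - φ).toReal) h).2 ?_
  rw [abs_of_pos (by positivity : (0 : ℝ) < 2 * Real.pi)]
  linarith [Real.Angle.abs_toReal_le_pi (φ' - φ)]

theorem cos_dist (φ φ' : Real.Angle) : Real.cos (dist φ φ') = (φ' - φ).cos := by
  rw [dist_eq_abs_toReal, Real.cos_abs, Real.Angle.cos_toReal]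

theorem dist_le_pi (φ φ' : Real.Angle) : dist φ φ' ≤ Real.pi := by
  rw [dist_eq_abs_toReal]; exact Real.Angle.abs_toReal_le_pi _

theorem subRiemannianDist_point_le (θ θ' η : ℝ) (φ φ' : Real.Angle)
    (h : dist φ φ' = 0 ∨ Real.sin η ≠ 0) :
    subRiemannianDist (point θ φ) (point θ' φ') ≤
      ENNReal.ofReal (|η - θ| + dist φ φ' * |Real.cos η / Real.sin η| + |θ' - η|) := by
  have := subRiemannianDist_chart_le θ θ' η φ.toReal (φ' - φ).toReal
    (h.imp_left fun h => by rwa [dist_eq_abs_toReal, abs_eq_zero] at h)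
  rw [Real.Angle.coe_add, Real.Angle.coe_toReal, Real.Angle.coe_toReal, add_sub_cancel,
    abs_mul, ← dist_eq_abs_toReal] at this
  exact this

theorem coe_point_eq_chart (θ : ℝ) (φ : Real.Angle) : (point θ φ : R3) = chart θ φ.toReal := by
  rw [← coe_point, Real.Angle.coe_toReal]

theorem cos_toReal_sub_toReal (φ φ' : Real.Angle) :
    Real.cos (φ.toReal - φ'.toReal) = Real.cos (dist φ φ') := by
  rw [dist_comm, cos_dist, ← Real.Angle.cos_coe, Real.Angle.coe_sub, Real.Angle.coe_toReal,
    Real.Angle.coe_toReal]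

theorem one_sub_cos_ge {u : ℝ} (hu : |u| ≤ Real.pi) : u ^ 2 / 5 ≤ 1 - Real.cos u := by
  have h := Real.cos_le_one_sub_mul_cos_sq hu
  have hpi : 1 / 5 ≤ 2 / Real.pi ^ 2 := by
    rw [div_le_div_iff₀ (by norm_num) (by positivity)]
    nlinarith [Real.pi_lt_d2, Real.pi_pos]
  nlinarith [mul_le_mul_of_nonneg_right hpi (sq_nonneg u)]

theorem norm_point_sub_sq (θ θ' : ℝ) (φ φ' : Real.Angle) :
    ‖(point θ' φ' : R3) - point θ φ‖ ^ 2 = 2 * (1 - Real.cos (θ - θ')) +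
      2 * (Real.cos θ * Real.cos θ') * (1 - Real.cos (dist φ φ')) := by
  rw [norm_sub_rev, coe_point_eq_chart, coe_point_eq_chart, norm_chart_sub_sq,
    cos_toReal_sub_toReal]

theorem horizontal_point_sub_sq (θ θ' : ℝ) (φ φ' : Real.Angle) :
    ((point θ' φ' : R3) 0 - (point θ φ : R3) 0) ^ 2 +
      ((point θ' φ' : R3) 1 - (point θ φ : R3) 1) ^ 2 = (Real.cos θ - Real.cos θ') ^ 2 +
      2 * (Real.cos θ * Real.cos θ') * (1 - Real.cos (dist φ φ')) := by
  rw [coe_point_eq_chart, coe_point_eq_chart, ← cos_toReal_sub_toReal, Real.cos_sub]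
  simp only [chart, PiLp.toLp_apply, Matrix.cons_val_zero, Matrix.cons_val_one]
  linear_combination (Real.cos θ) ^ 2 * Real.sin_sq_add_cos_sq φ.toReal +
    (Real.cos θ') ^ 2 * Real.sin_sq_add_cos_sq φ'.toReal

/-! ### The model distance in real terms -/

/-- The contribution of the longitudes to the model distance: `d` is the difference of the
longitudes, `s` and `c` are the sine and the cosine of the larger latitude. -/
def gap (s c d : ℝ) : ℝ := if s = 0 then √d else min √d (d * c / s)

theorem gap_nonneg {s c d : ℝ} (hs : 0 ≤ s) (hc : 0 ≤ c) (hd : 0 ≤ d) : 0 ≤ gap s c d := by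
  unfold gap
  split_ifs <;> positivity

/-- If `s ≥ 1/2`, the chord bound `h1` controls the quotient. Otherwise `c ≥ 4/5`, and `h2` gives `d
≲ r²` when `s ≤ r` and `c * d ≤ 4 * r * s` when `s > r`. -/
theorem gap_le {s c d r : ℝ} (hs : 0 ≤ s) (hc : 0 ≤ c) (hsc : s ^ 2 + c ^ 2 = 1) (hd : 0 ≤ d)
    (hr : 0 ≤ r) (h1 : c * d ≤ 2 * r) (h2 : c * d ≤ 2 * (r * (r + s))) : gap s c d ≤ 4 * r := by
  have hsqrt : gap s c d ≤ √d := by unfold gap; split_ifs <;> simp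
  have hdiv : 0 < s → gap s c d ≤ d * c / s := fun h => by
    unfold gap; rw [if_neg h.ne']; exact min_le_right _ _
  rcases le_or_gt (1 / 2) s with h | h
  · refine (hdiv (by linarith)).trans ?_
    rw [div_le_iff₀ (by linarith)]
    nlinarith
  · have hc' : 4 / 5 ≤ c := by nlinarith
    rcases le_or_gt s r with hsr | hsr
    · refine hsqrt.trans (Real.sqrt_le_iff.2 ⟨by positivity, ?_⟩)
      nlinarith
    · refine (hdiv (by linarith)).trans ?_
      rw [div_le_iff₀ (by linarith)]
      nlinarith

theorem abs_sin_le_abs_sin {x y : ℝ} (hy : |y| ≤ Real.pi / 2) (h : |x| ≤ |y|) :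
    |Real.sin x| ≤ |Real.sin y| := by
  have hp := Real.pi_pos
  rw [Real.abs_sin_eq_sin_abs_of_abs_le_pi (by linarith),
    Real.abs_sin_eq_sin_abs_of_abs_le_pi (by linarith)]
  exact Real.sin_le_sin_of_le_of_le_pi_div_two (by linarith [abs_nonneg x]) hy h

theorem cos_le_cos_of_abs_le_abs {x y : ℝ} (hy : |y| ≤ Real.pi / 2) (h : |x| ≤ |y|) :
    Real.cos y ≤ Real.cos x := by
  have hp := Real.pi_pos
  rw [← Real.cos_abs x, ← Real.cos_abs y]
  exact Real.cos_le_cos_of_nonneg_of_le_pi (abs_nonneg _) (by linarith) h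

theorem cos_nonneg_of_abs_le {x : ℝ} (hx : |x| ≤ Real.pi / 2) : 0 ≤ Real.cos x :=
  Real.cos_nonneg_of_mem_Icc (abs_le.1 hx)

theorem absTan_le_absTan {x y : ℝ} (hy : |y| ≤ Real.pi / 2) (h : |x| ≤ |y|) :
    absTan x ≤ absTan y := by
  refine ENNReal.div_le_div (ENNReal.ofReal_le_ofReal (abs_sin_le_abs_sin hy h))
    (ENNReal.ofReal_le_ofReal ?_)
  rw [abs_of_nonneg (cos_nonneg_of_abs_le hy), abs_of_nonneg (cos_nonneg_of_abs_le (h.trans hy))]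
  exact cos_le_cos_of_abs_le_abs hy h

theorem abs_le_two_mul_abs_sin {x : ℝ} (hx : |x| ≤ Real.pi / 2) : |x| ≤ 2 * |Real.sin x| := by
  have h := Real.mul_abs_le_abs_sin hx
  have hpi : 1 / 2 ≤ 2 / Real.pi := by
    rw [div_le_div_iff₀ (by norm_num) Real.pi_pos]; linarith [Real.pi_le_four]
  nlinarith [mul_le_mul_of_nonneg_right hpi (abs_nonneg x)]

/-- The conventions agree: at the equator the quotient is `∞`, or `0` if `d = 0`, when both sides
vanish; at a pole it is `0`, as is `d * 0 / s`. -/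
theorem min_eq_ofReal_gap {θ d : ℝ} (hθ : |θ| ≤ Real.pi / 2) (hd : 0 ≤ d) :
    min (ENNReal.ofReal d ^ (1 / 2 : ℝ)) (ENNReal.ofReal d / absTan θ) =
      ENNReal.ofReal (gap |Real.sin θ| (Real.cos θ) d) := by
  have hc := cos_nonneg_of_abs_le hθ
  rw [ENNReal.ofReal_rpow_of_nonneg hd (by norm_num), ← Real.sqrt_eq_rpow, gap, absTan,
    abs_of_nonneg hc]
  split_ifs with hs
  · rw [hs, ENNReal.ofReal_zero, ENNReal.zero_div]
    rcases hd.eq_or_lt with rfl | hd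
    · simp
    · rw [ENNReal.div_zero (by simpa using hd), min_eq_left le_top]
  · have hs' : 0 < |Real.sin θ| := lt_of_le_of_ne (abs_nonneg _) (Ne.symm hs)
    rw [ENNReal.ofReal_min]
    congr 1
    rcases hc.eq_or_lt with hc | hc
    · rw [← hc, ENNReal.ofReal_zero, ENNReal.div_zero (by simpa using hs')]
      simp
    · rw [← ENNReal.ofReal_div_of_pos hc, ← ENNReal.ofReal_div_of_pos (by positivity)]
      congr 1
      field_simp

theorem model_eq {θ θ' Θ : ℝ} (φ φ' : Real.Angle) (hΘ : |Θ| ≤ Real.pi / 2) (h : Θ = θ ∨ Θ = θ')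
    (h1 : |θ| ≤ |Θ|) (h2 : |θ'| ≤ |Θ|) :
    model θ φ θ' φ' = ENNReal.ofReal
      (|θ - θ'| + gap |Real.sin Θ| (Real.cos Θ) (dist φ φ')) := by
  have hmax : max (absTan θ) (absTan θ') = absTan Θ := by
    rcases h with rfl | rfl
    · exact max_eq_left (absTan_le_absTan hΘ h2)
    · exact max_eq_right (absTan_le_absTan hΘ h1)
  rw [model, hmax, min_eq_ofReal_gap hΘ dist_nonneg, ENNReal.ofReal_add (abs_nonneg _)
    (gap_nonneg (abs_nonneg _) (cos_nonneg_of_abs_le hΘ) dist_nonneg)]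

theorem exists_larger_latitude (θ θ' : ℝ) :
    ∃ Θ, (Θ = θ ∨ Θ = θ') ∧ |θ| ≤ |Θ| ∧ |θ'| ≤ |Θ| := by
  rcases le_total |θ| |θ'| with h | h
  · exact ⟨θ', Or.inr rfl, h, le_rfl⟩
  · exact ⟨θ, Or.inl rfl, le_rfl, h⟩

/-! ### Upper bound by the model -/

theorem subRiemannianDist_le_model {θ θ' : ℝ} (hθ : |θ| ≤ Real.pi / 2) (hθ' : |θ'| ≤ Real.pi / 2)
    (φ φ' : Real.Angle) :
    subRiemannianDist (point θ φ) (point θ' φ') ≤ (7 : ℝ≥0) * model θ φ θ' φ' := by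
  obtain ⟨Θ, h, h1, h2⟩ := exists_larger_latitude θ θ'
  have hΘ : |Θ| ≤ Real.pi / 2 := by rcases h with rfl | rfl <;> assumption
  have hc := cos_nonneg_of_abs_le hΘ
  have hd : 0 ≤ dist φ φ' := dist_nonneg
  rw [model_eq φ φ' hΘ h h1 h2]
  set d := dist φ φ' with hdd
  have e7 : ((7 : ℝ≥0) : ℝ≥0∞) = ENNReal.ofReal 7 := by simp
  rw [e7, ← ENNReal.ofReal_mul (by norm_num)]
  have hg := gap_nonneg (abs_nonneg (Real.sin Θ)) hc hd
  -- If the quotient realises the minimum, the parallel is taken at `Θ`; one of the meridian legs is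
  -- then trivial.
  by_cases hcase : d = 0 ∨ (Real.sin Θ ≠ 0 ∧ d * Real.cos Θ / |Real.sin Θ| ≤ √d)
  · refine (subRiemannianDist_point_le θ θ' Θ φ φ' (hcase.imp id And.left)).trans
      (ENNReal.ofReal_le_ofReal ?_)
    have e1 : |Θ - θ| + |θ' - Θ| = |θ - θ'| := by
      rcases h with rfl | rfl
      · simp [abs_sub_comm]
      · simp [abs_sub_comm]
    have e2 : d * |Real.cos Θ / Real.sin Θ| ≤ gap |Real.sin Θ| (Real.cos Θ) d := by
      rcases hcase with h0 | ⟨h0, h3⟩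
      · rw [h0] at hg ⊢; rwa [zero_mul]
      · rw [gap, if_neg (by simpa using h0), min_eq_right h3, abs_div, abs_of_nonneg hc,
          mul_div_assoc]
    rw [← hdd]
    nlinarith [abs_nonneg (θ - θ')]
  · rw [not_or, not_and, not_le] at hcase
    obtain ⟨h0, h3⟩ := hcase
    have hd0 : 0 < √d := Real.sqrt_pos.2 (lt_of_le_of_ne hd (Ne.symm h0))
    have hds : √d * √d = d := Real.mul_self_sqrt hd
    have hgap : gap |Real.sin Θ| (Real.cos Θ) d = √d := by
      unfold gap
      split_ifs with hs
      · rfl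
      · exact min_eq_left (h3 (by simpa using hs)).le
    have hsin : |Real.sin Θ| ≤ √d := by
      by_cases hs : Real.sin Θ = 0
      · simp [hs]
      · have := h3 hs
        rw [lt_div_iff₀ (abs_pos.2 hs)] at this
        nlinarith [Real.cos_le_one Θ]
    have hΘd : |Θ| ≤ 2 * √d := (abs_le_two_mul_abs_sin hΘ).trans (by linarith)
    -- Here `|sin Θ| ≤ √d`, so both latitudes are `O(√d)`. This `η` makes the parallel leg cost
    -- `√d`; the meridian legs cost at most `3√d` each, whence the constant 7.
    set η := Real.arctan √d with hη
    have htan : Real.tan η = √d := Real.tan_arctan _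
    have hη0 : 0 < η := Real.arctan_pos.2 hd0
    have hηd : η ≤ √d := by
      rw [← htan]; exact Real.le_tan hη0.le (Real.arctan_lt_pi_div_two _)
    have hsη : Real.sin η ≠ 0 := by
      intro h
      rw [Real.tan_eq_sin_div_cos, h, zero_div] at htan
      exact hd0.ne htan
    refine (subRiemannianDist_point_le θ θ' η φ φ' (Or.inr hsη)).trans
      (ENNReal.ofReal_le_ofReal ?_)
    have hcot : Real.cos η / Real.sin η = 1 / √d := by
      rw [← htan, Real.tan_eq_sin_div_cos, one_div_div]
    rw [hcot, abs_of_pos (one_div_pos.2 hd0), hgap, ← hdd]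
    have e3 : d * (1 / √d) = √d := by field_simp; exact (Real.sq_sqrt hd).symm
    have e1 : |η - θ| ≤ 3 * √d := (abs_sub _ _).trans (by rw [abs_of_pos hη0]; linarith)
    have e2 : |θ' - η| ≤ 3 * √d := (abs_sub _ _).trans (by rw [abs_of_pos hη0]; linarith)
    rw [e3]
    linarith [abs_nonneg (θ - θ')]

/-! ### Lower bound by the model -/

theorem abs_latitude_sub_le {θ θ' : ℝ} (hθ : |θ| ≤ Real.pi / 2) (hθ' : |θ'| ≤ Real.pi / 2)
    (φ φ' : Real.Angle) : |θ - θ'| ≤ 2 * ‖(point θ' φ' : R3) - point θ φ‖ := by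
  have h := norm_point_sub_sq θ θ' φ φ'
  have h1 := one_sub_cos_ge (u := θ - θ') ((abs_sub _ _).trans (by linarith))
  have h2 : 0 ≤ Real.cos θ * Real.cos θ' * (1 - Real.cos (dist φ φ')) :=
    mul_nonneg (mul_nonneg (cos_nonneg_of_abs_le hθ) (cos_nonneg_of_abs_le hθ'))
      (by linarith [Real.cos_le_one (dist φ φ')])
  refine abs_le_of_sq_le_sq ?_ (by positivity)
  nlinarith [sq_nonneg ‖(point θ' φ' : R3) - point θ φ‖]

theorem cos_mul_dist_sq_le {θ θ' Θ : ℝ} (φ φ' : Real.Angle) (hΘ : |Θ| ≤ Real.pi / 2)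
    (h1 : |θ| ≤ |Θ|) (h2 : |θ'| ≤ |Θ|) :
    (Real.cos Θ * dist φ φ') ^ 2 ≤
      5 * (Real.cos θ * Real.cos θ' * (1 - Real.cos (dist φ φ'))) := by
  have hc := cos_nonneg_of_abs_le hΘ
  have c1 := cos_le_cos_of_abs_le_abs hΘ h1
  have c2 := cos_le_cos_of_abs_le_abs hΘ h2
  have h := one_sub_cos_ge (u := dist φ φ') (by
    rw [abs_of_nonneg dist_nonneg]; exact dist_le_pi _ _)
  have h3 : Real.cos Θ * Real.cos Θ ≤ Real.cos θ * Real.cos θ' :=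
    mul_le_mul c1 c2 hc (hc.trans c1)
  calc _ = 5 * (Real.cos Θ * Real.cos Θ * (dist φ φ' ^ 2 / 5)) := by ring
    _ ≤ _ := by
      gcongr
      exact (mul_nonneg hc hc).trans h3

theorem cos_mul_dist_le_norm {θ θ' Θ : ℝ} (φ φ' : Real.Angle) (hΘ : |Θ| ≤ Real.pi / 2)
    (h1 : |θ| ≤ |Θ|) (h2 : |θ'| ≤ |Θ|) :
    Real.cos Θ * dist φ φ' ≤ 2 * ‖(point θ' φ' : R3) - point θ φ‖ := by
  refine (abs_le_of_sq_le_sq' ?_ (by positivity)).2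
  have h := norm_point_sub_sq θ θ' φ φ'
  have := cos_mul_dist_sq_le φ φ' hΘ h1 h2
  nlinarith [Real.cos_le_one (θ - θ'), sq_nonneg ‖(point θ' φ' : R3) - point θ φ‖]

/-- Test with the unit vector in the direction of `(x, y)`. -/
theorem sq_add_sq_le_of_forall_unit {x y B : ℝ}
    (h : ∀ p q : ℝ, p ^ 2 + q ^ 2 = 1 → |p * x + q * y| ≤ B) : x ^ 2 + y ^ 2 ≤ B ^ 2 := by
  rcases (by positivity : 0 ≤ x ^ 2 + y ^ 2).eq_or_lt with h0 | h0
  · rw [← h0]; positivity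
  · have hs : 0 < √(x ^ 2 + y ^ 2) := Real.sqrt_pos.2 h0
    have hsq : √(x ^ 2 + y ^ 2) ^ 2 = x ^ 2 + y ^ 2 := Real.sq_sqrt h0.le
    have := h (x / √(x ^ 2 + y ^ 2)) (y / √(x ^ 2 + y ^ 2)) (by
      rw [div_pow, div_pow, hsq, ← add_div, div_self h0.ne'])
    have e : x / √(x ^ 2 + y ^ 2) * x + y / √(x ^ 2 + y ^ 2) * y = √(x ^ 2 + y ^ 2) := by
      field_simp
      exact hsq.symm
    rw [e, abs_of_pos hs] at this
    rw [← hsq]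
    gcongr

theorem model_le_of_subRiemannianDist_lt {θ θ' r : ℝ} (hθ : |θ| ≤ Real.pi / 2)
    (hθ' : |θ'| ≤ Real.pi / 2) (φ φ' : Real.Angle) (hr : 0 ≤ r)
    (h : subRiemannianDist (point θ φ) (point θ' φ') < ENNReal.ofReal r) :
    model θ φ θ' φ' ≤ ENNReal.ofReal (6 * r) := by
  obtain ⟨Θ, hh, h1, h2⟩ := exists_larger_latitude θ θ'
  have hΘ : |Θ| ≤ Real.pi / 2 := by rcases hh with rfl | rfl <;> assumption
  have hc := cos_nonneg_of_abs_le hΘ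
  have hnorm := norm_sub_le_of_subRiemannianDist_lt h
  rw [model_eq φ φ' hΘ hh h1 h2]
  refine ENNReal.ofReal_le_ofReal ?_
  have a1 := abs_latitude_sub_le hθ hθ' φ φ'
  have a2 := cos_mul_dist_le_norm φ φ' hΘ h1 h2
  have a3 : Real.cos Θ * dist φ φ' ≤ 2 * (r * (r + |Real.sin Θ|)) := by
    refine (abs_le_of_sq_le_sq' ?_ (by positivity)).2
    have b1 := sq_add_sq_le_of_forall_unit (B := r * (r + |(point θ φ : R3) 2|))
      fun p q hpq => abs_horizontal_component_le h hpq
    rw [horizontal_point_sub_sq] at b1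
    have b2 := cos_mul_dist_sq_le φ φ' hΘ h1 h2
    have b3 : |(point θ φ : R3) 2| ≤ |Real.sin Θ| := by
      simpa [point] using abs_sin_le_abs_sin hΘ h1
    have b4 : (r * (r + |(point θ φ : R3) 2|)) ^ 2 ≤ (r * (r + |Real.sin Θ|)) ^ 2 := by
      gcongr
    nlinarith [sq_nonneg (Real.cos θ - Real.cos θ'), sq_nonneg (r * (r + |Real.sin Θ|))]
  have := gap_le (abs_nonneg (Real.sin Θ)) hc (by rw [sq_abs]; exact Real.sin_sq_add_cos_sq Θ)
    (dist_nonneg (x := φ) (y := φ')) hr (by linarith) a3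
  linarith

theorem model_le_subRiemannianDist {θ θ' : ℝ} (hθ : |θ| ≤ Real.pi / 2) (hθ' : |θ'| ≤ Real.pi / 2)
    (φ φ' : Real.Angle) :
    model θ φ θ' φ' ≤ (7 : ℝ≥0) * subRiemannianDist (point θ φ) (point θ' φ') := by
  set ρ := subRiemannianDist (point θ φ) (point θ' φ') with hρ
  have h6 : model θ φ θ' φ' ≤ (6 : ℝ≥0) * ρ := by
    rw [mul_comm, ← ENNReal.div_le_iff_le_mul (by simp) (by simp)]
    -- The infimum need not be attained, so the bound is applied to every larger `x`.
    refine le_of_forall_gt_imp_ge_of_dense fun x hx => ?_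
    rcases eq_or_ne x ⊤ with rfl | hx'
    · exact le_top
    have e : x = ENNReal.ofReal x.toReal := (ENNReal.ofReal_toReal hx').symm
    rw [e] at hx
    have := model_le_of_subRiemannianDist_lt hθ hθ' φ φ' ENNReal.toReal_nonneg hx
    rw [ENNReal.ofReal_mul (by norm_num), ← e] at this
    rw [ENNReal.div_le_iff_le_mul (by simp) (by simp), mul_comm]
    simpa using this
  refine h6.trans ?_
  gcongr
  norm_num

theorem comparable_model {θ θ' : ℝ} (hθ : |θ| ≤ Real.pi / 2) (hθ' : |θ'| ≤ Real.pi / 2)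
    (φ φ' : Real.Angle) :
    Comparable 7 (subRiemannianDist (point θ φ) (point θ' φ')) (model θ φ θ' φ') :=
  ⟨subRiemannianDist_le_model hθ hθ' φ φ', model_le_subRiemannianDist hθ hθ' φ φ'⟩

theorem model_zero_zero (φ φ' : Real.Angle) :
    model 0 φ 0 φ' = ENNReal.ofReal (dist φ φ' ^ (1 / 2 : ℝ)) := by
  rw [model_eq (Θ := 0) φ φ' (by simpa using Real.pi_div_two_pos.le) (Or.inl rfl) le_rfl le_rfl]
  simp [gap, Real.sqrt_eq_rpow]

/-! ### Comparison with the Riemannian distance -/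

theorem model_le_norm {θ θ' ε : ℝ} (hθ : |θ| ≤ Real.pi / 2) (hθ' : |θ'| ≤ Real.pi / 2)
    (φ φ' : Real.Angle) (hε : 0 < ε) (h : ε ≤ max |θ| |θ'|) :
    model θ φ θ' φ' ≤ ENNReal.ofReal ((2 + 4 / ε) * ‖(point θ' φ' : R3) - point θ φ‖) := by
  obtain ⟨Θ, hh, h1, h2⟩ := exists_larger_latitude θ θ'
  have hΘ : |Θ| ≤ Real.pi / 2 := by rcases hh with rfl | rfl <;> assumption
  rw [model_eq φ φ' hΘ hh h1 h2]
  refine ENNReal.ofReal_le_ofReal ?_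
  have a1 := abs_latitude_sub_le hθ hθ' φ φ'
  have a2 := cos_mul_dist_le_norm φ φ' hΘ h1 h2
  have hs : ε / 2 ≤ |Real.sin Θ| := by
    have := abs_le_two_mul_abs_sin hΘ
    have := h.trans (max_le h1 h2)
    linarith
  have hs0 : 0 < |Real.sin Θ| := by linarith
  have hgap : gap |Real.sin Θ| (Real.cos Θ) (dist φ φ') ≤
      4 / ε * ‖(point θ' φ' : R3) - point θ φ‖ := by
    rw [gap, if_neg hs0.ne']
    refine (min_le_right _ _).trans ?_
    rw [mul_comm (dist φ φ')]
    calc _ ≤ 2 * ‖(point θ' φ' : R3) - point θ φ‖ / (ε / 2) := by gcongr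
      _ = _ := by ring
  linarith

theorem subRiemannianDist_le_norm {θ θ' ε : ℝ} (hθ : |θ| ≤ Real.pi / 2)
    (hθ' : |θ'| ≤ Real.pi / 2) (φ φ' : Real.Angle) (hε : 0 < ε) (h : ε ≤ max |θ| |θ'|) :
    subRiemannianDist (point θ φ) (point θ' φ') ≤
      ENNReal.ofReal (7 * (2 + 4 / ε) * ‖(point θ' φ' : R3) - point θ φ‖) := by
  refine (subRiemannianDist_le_model hθ hθ' φ φ').trans ?_
  have e7 : ((7 : ℝ≥0) : ℝ≥0∞) = ENNReal.ofReal 7 := by simp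
  rw [mul_assoc, ENNReal.ofReal_mul (by norm_num), e7]
  gcongr
  exact model_le_norm hθ hθ' φ φ' hε h

theorem exists_comparable_riemannianDist {ε : ℝ} (hε : 0 < ε) : ∃ C : ℝ≥0, 0 < C ∧
    ∀ θ θ' : ℝ, |θ| ≤ Real.pi / 2 → |θ'| ≤ Real.pi / 2 → ∀ φ φ' : Real.Angle,
      ε ≤ max |θ| |θ'| →
        Comparable C (subRiemannianDist (point θ φ) (point θ' φ'))
          (riemannianDist (point θ φ) (point θ' φ')) := by
  have hC : 0 ≤ 7 * (2 + 4 / ε) := by positivity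
  refine ⟨Real.toNNReal (7 * (2 + 4 / ε)), by simp; positivity,
    fun θ θ' hθ hθ' φ φ' h => ⟨?_, ?_⟩⟩
  · refine (subRiemannianDist_le_norm hθ hθ' φ φ' hε h).trans ?_
    rw [ENNReal.ofReal_mul hC, ofReal_norm]
    exact mul_le_mul_right (enorm_sub_le_riemannianDist _ _) _
  · refine (riemannianDist_le_subRiemannianDist _ _).trans ?_
    refine le_mul_of_one_le_left zero_le ?_
    rw [← ENNReal.ofReal, ENNReal.one_le_ofReal]
    have : 0 < 4 / ε := by positivity
    linarith

/-! ### Surface measure of patches in an orthonormal frame -/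

open scoped Pointwise

/-- The coordinates with respect to the orthonormal frame which consists of `chart θ x` and of the
directions of increasing longitude and latitude. -/
def frame (θ x : ℝ) : R3 →ₗᵢ[ℝ] R3 where
  toFun p := !₂[Real.cos θ * Real.cos x * p 0 + Real.cos θ * Real.sin x * p 1 + Real.sin θ * p 2,
    -Real.sin x * p 0 + Real.cos x * p 1,
    -Real.sin θ * Real.cos x * p 0 - Real.sin θ * Real.sin x * p 1 + Real.cos θ * p 2]
  map_add' p q := by
    ext i
    fin_cases i <;> simp <;> ring
  map_smul' c p := by
    ext i
    fin_cases i <;> simp <;> ring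
  norm_map' p := by
    refine (sq_eq_sq₀ (norm_nonneg _) (norm_nonneg _)).1 ?_
    rw [norm_sq_eq, norm_sq_eq]
    simp
    have h1 := Real.sin_sq_add_cos_sq θ
    have h2 := Real.sin_sq_add_cos_sq x
    linear_combination ((Real.cos x * p 0 + Real.sin x * p 1) ^ 2 + p 2 ^ 2) * h1 +
      (p 0 ^ 2 + p 1 ^ 2) * h2

theorem frame_apply_one (θ x : ℝ) (p : R3) :
    frame θ x p 1 = -Real.sin x * p 0 + Real.cos x * p 1 := rfl

theorem frame_chart (θ x : ℝ) : frame θ x (chart θ x) = !₂[1, 0, 0] := by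
  have h1 := Real.sin_sq_add_cos_sq θ
  have h2 := Real.sin_sq_add_cos_sq x
  ext i
  fin_cases i
  · simp [frame, chart]
    linear_combination h1 + Real.cos θ ^ 2 * h2
  · simp [frame, chart]
    ring
  · simp [frame, chart]
    linear_combination -Real.sin θ * Real.cos θ * h2

theorem frame_sq_sum (θ x : ℝ) (p : R3) :
    frame θ x p 0 ^ 2 + frame θ x p 1 ^ 2 + frame θ x p 2 ^ 2 = ‖p‖ ^ 2 := by
  rw [← norm_sq_eq, LinearIsometry.norm_map]

theorem volume_frame_box (θ x : ℝ) {s₀ s₁ s₂ : Set ℝ} (h₀ : MeasurableSet s₀)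
    (h₁ : MeasurableSet s₁) (h₂ : MeasurableSet s₂) :
    volume {p : R3 | frame θ x p 0 ∈ s₀ ∧ frame θ x p 1 ∈ s₁ ∧ frame θ x p 2 ∈ s₂} =
      volume s₀ * volume s₁ * volume s₂ := by
  have hF := ((frame θ x).toLinearIsometryEquiv rfl).measurePreserving
  have hG := PiLp.volume_preserving_ofLp (Fin 3)
  have hS : MeasurableSet (univ.pi ![s₀, s₁, s₂]) := by
    refine MeasurableSet.univ_pi fun i => ?_
    fin_cases i <;> assumption
  have h := (hG.comp hF).measure_preimage hS.nullMeasurableSet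
  rw [volume_pi_pi, Fin.prod_univ_three] at h
  refine Eq.trans ?_ h
  congr 1
  ext p
  simp [Fin.forall_fin_succ]

theorem measurable_frame_apply (θ x : ℝ) (i : Fin 3) :
    Measurable fun w : S2 => frame θ x (w : R3) i :=
  ((EuclideanSpace.proj (𝕜 := ℝ) i).continuous.comp
    ((frame θ x).continuous.comp continuous_subtype_val)).measurable

theorem surfaceMeasure_apply {s : Set S2} (hs : MeasurableSet s) :
    surfaceMeasure s = 3 * volume (Ioo (0 : ℝ) 1 • ((↑) '' s : Set R3)) := by
  rw [surfaceMeasure, Measure.toSphere_apply' _ hs]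
  simp

/-- The cone over the patch lies in a box of sides `2`, `2δ`, `2η`; three times its volume is
`24δη`. -/
theorem surfaceMeasure_le (θ x : ℝ) {δ η : ℝ} (hδ : 0 ≤ δ) :
    surfaceMeasure {w : S2 | |frame θ x (w : R3) 1| ≤ δ ∧ |frame θ x (w : R3) 2| ≤ η} ≤
      ENNReal.ofReal (24 * (δ * η)) := by
  have hm : MeasurableSet
      {w : S2 | |frame θ x (w : R3) 1| ≤ δ ∧ |frame θ x (w : R3) 2| ≤ η} :=
    (measurableSet_le (measurable_frame_apply θ x 1).abs measurable_const).inter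
      (measurableSet_le (measurable_frame_apply θ x 2).abs measurable_const)
  rw [surfaceMeasure_apply hm]
  have hsub : Ioo (0 : ℝ) 1 • ((↑) '' {w : S2 | |frame θ x (w : R3) 1| ≤ δ ∧
      |frame θ x (w : R3) 2| ≤ η} : Set R3) ⊆ {p : R3 | frame θ x p 0 ∈ Icc (-1) 1 ∧
        frame θ x p 1 ∈ Icc (-δ) δ ∧ frame θ x p 2 ∈ Icc (-η) η} := by
    rintro _ ⟨t, ht, _, ⟨w, ⟨h1, h2⟩, rfl⟩, rfl⟩
    have hw : |frame θ x (w : R3) 0| ≤ 1 := by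
      have h := PiLp.norm_apply_le (frame θ x (w : R3)) 0
      rwa [LinearIsometry.norm_map, norm_eq_of_mem_sphere, Real.norm_eq_abs] at h
    have key : ∀ {y B : ℝ}, |y| ≤ B → t * y ∈ Icc (-B) B := fun {y B} h => by
      rw [mem_Icc, ← abs_le, abs_mul, abs_of_pos ht.1]
      exact (mul_le_of_le_one_left (abs_nonneg _) ht.2.le).trans h
    simp only [mem_ofPred_eq, map_smul, PiLp.smul_apply, smul_eq_mul]
    exact ⟨key hw, key h1, key h2⟩
  calc _ ≤ 3 * volume {p : R3 | frame θ x p 0 ∈ Icc (-1) 1 ∧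
        frame θ x p 1 ∈ Icc (-δ) δ ∧ frame θ x p 2 ∈ Icc (-η) η} := by gcongr
    _ = ENNReal.ofReal (24 * (δ * η)) := by
      rw [volume_frame_box θ x measurableSet_Icc measurableSet_Icc measurableSet_Icc,
        Real.volume_Icc, Real.volume_Icc, Real.volume_Icc, ← ENNReal.ofReal_mul (by norm_num),
        ← ENNReal.ofReal_mul (by nlinarith), ← ENNReal.ofReal_ofNat 3,
        ← ENNReal.ofReal_mul (by norm_num)]
      congr 1
      ring

/-- The conditions are invariant under positive scaling, so the cone contains every point of the
open unit ball satisfying them, in particular a box of sides `1/4`, `δ/2`, `η/2`. -/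
theorem le_surfaceMeasure (θ x : ℝ) {δ η : ℝ} (hδ : 0 ≤ δ) (hη : 0 ≤ η) (hδ1 : δ ≤ 1)
    (hη1 : η ≤ 1) :
    ENNReal.ofReal (3 / 16 * (δ * η)) ≤
      surfaceMeasure {w : S2 | 0 < frame θ x (w : R3) 0 ∧
        |frame θ x (w : R3) 1| ≤ δ * frame θ x (w : R3) 0 ∧
        |frame θ x (w : R3) 2| ≤ η * frame θ x (w : R3) 0} := by
  have hm : MeasurableSet {w : S2 | 0 < frame θ x (w : R3) 0 ∧
        |frame θ x (w : R3) 1| ≤ δ * frame θ x (w : R3) 0 ∧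
        |frame θ x (w : R3) 2| ≤ η * frame θ x (w : R3) 0} :=
    (measurableSet_lt measurable_const (measurable_frame_apply θ x 0)).inter
      ((measurableSet_le (measurable_frame_apply θ x 1).abs
        ((measurable_frame_apply θ x 0).const_mul δ)).inter
      (measurableSet_le (measurable_frame_apply θ x 2).abs
        ((measurable_frame_apply θ x 0).const_mul η)))
  rw [surfaceMeasure_apply hm]
  have hsub : {p : R3 | frame θ x p 0 ∈ Ioo (1 / 4) (1 / 2) ∧
        frame θ x p 1 ∈ Icc (-(δ / 4)) (δ / 4) ∧ frame θ x p 2 ∈ Icc (-(η / 4)) (η / 4)} ⊆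
      Ioo (0 : ℝ) 1 • ((↑) '' {w : S2 | 0 < frame θ x (w : R3) 0 ∧
        |frame θ x (w : R3) 1| ≤ δ * frame θ x (w : R3) 0 ∧
        |frame θ x (w : R3) 2| ≤ η * frame θ x (w : R3) 0} : Set R3) := by
    rintro p ⟨h0, h1, h2⟩
    have hp := frame_sq_sum θ x p
    rw [mem_Icc, ← abs_le] at h1 h2
    have hp0 : 0 < ‖p‖ := by
      refine norm_pos_iff.2 fun h => ?_
      rw [h, map_zero] at h0
      have := h0.1
      simp at this
      linarith
    have hp1 : ‖p‖ < 1 := by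
      have b1 := sq_le_sq' (abs_le.1 (h1.trans (by linarith : δ / 4 ≤ 1 / 4))).1
        (abs_le.1 (h1.trans (by linarith : δ / 4 ≤ 1 / 4))).2
      have b2 := sq_le_sq' (abs_le.1 (h2.trans (by linarith : η / 4 ≤ 1 / 4))).1
        (abs_le.1 (h2.trans (by linarith : η / 4 ≤ 1 / 4))).2
      nlinarith [h0.1, h0.2]
    refine ⟨‖p‖, ⟨hp0, hp1⟩, ‖p‖⁻¹ • p, ⟨⟨‖p‖⁻¹ • p, ?_⟩, ?_, rfl⟩, ?_⟩
    · rw [mem_sphere_zero_iff_norm, norm_smul, norm_inv, norm_norm, inv_mul_cancel₀ hp0.ne']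
    · have hi : 0 < ‖p‖⁻¹ := inv_pos.2 hp0
      simp only [mem_ofPred_eq, map_smul, PiLp.smul_apply, smul_eq_mul, abs_mul, abs_of_pos hi]
      refine ⟨mul_pos hi (by linarith [h0.1]), ?_, ?_⟩
      · rw [mul_left_comm]
        gcongr
        nlinarith [h0.1]
      · rw [mul_left_comm]
        gcongr
        nlinarith [h0.1]
    · exact smul_inv_smul₀ hp0.ne' p
  calc ENNReal.ofReal (3 / 16 * (δ * η))
      = 3 * volume {p : R3 | frame θ x p 0 ∈ Ioo (1 / 4) (1 / 2) ∧
        frame θ x p 1 ∈ Icc (-(δ / 4)) (δ / 4) ∧ frame θ x p 2 ∈ Icc (-(η / 4)) (η / 4)} := by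
          rw [volume_frame_box θ x measurableSet_Ioo measurableSet_Icc measurableSet_Icc,
            Real.volume_Ioo, Real.volume_Icc, Real.volume_Icc, ← ENNReal.ofReal_mul (by norm_num),
            ← ENNReal.ofReal_mul (by nlinarith), ← ENNReal.ofReal_ofNat 3,
            ← ENNReal.ofReal_mul (by norm_num)]
          congr 1
          ring
    _ ≤ _ := by gcongr

/-! ### Volume of balls -/

theorem exists_eq_point (w : S2) : ∃ θ : ℝ, |θ| ≤ Real.pi / 2 ∧ ∃ φ : Real.Angle,
    w = point θ φ := by
  have hw := sum_sq_eq_one_of_mem_sphere w.2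
  set c : ℂ := ⟨(w : R3) 0, (w : R3) 1⟩ with hc
  have hn : Real.cos (Real.arcsin ((w : R3) 2)) = ‖c‖ := by
    rw [Real.cos_arcsin, Complex.norm_eq_sqrt_sq_add_sq]
    congr 1
    simp only [hc]
    linarith
  have h2 : |(w : R3) 2| ≤ 1 := by
    refine abs_le_of_sq_le_sq ?_ one_pos.le
    nlinarith [sq_nonneg ((w : R3) 0), sq_nonneg ((w : R3) 1)]
  refine ⟨Real.arcsin ((w : R3) 2), abs_le.2 (Real.arcsin_mem_Icc _),
    ((Complex.arg c : ℝ) : Real.Angle), Subtype.ext ?_⟩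
  rw [coe_point]
  ext i
  fin_cases i
  · simp [chart, hn, hc]
  · simp [chart, hn, hc]
  · simp [chart, Real.sin_arcsin (abs_le.1 h2).1 (abs_le.1 h2).2]

theorem ballVolume_le {θ : ℝ} (φ : Real.Angle) {r : ℝ} (hr : 0 < r) :
    ballVolume (point θ φ) r ≤ ENNReal.ofReal (48 * min 1 (r ^ 2 * max r |θ|)) := by
  have h1 : ballVolume (point θ φ) r ≤ ENNReal.ofReal (24 * (1 * 1)) := by
    refine le_trans (measure_mono fun w _ => ?_) (surfaceMeasure_le 0 0 zero_le_one)
    have h (i : Fin 3) := PiLp.norm_apply_le (frame 0 0 (w : R3)) i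
    simp only [LinearIsometry.norm_map, norm_eq_of_mem_sphere, Real.norm_eq_abs] at h
    exact ⟨h 1, h 2⟩
  have h2 : ballVolume (point θ φ) r ≤ ENNReal.ofReal (24 * (r * (r + |θ|) * r)) := by
    refine le_trans (measure_mono fun w hw => ?_)
      (surfaceMeasure_le θ φ.toReal (δ := r * (r + |θ|)) (by positivity))
    rw [mem_ofPred_eq] at hw
    have e := frame_chart θ φ.toReal
    rw [← coe_point_eq_chart] at e
    have hsub (i : Fin 3) : frame θ φ.toReal ((w : R3) - point θ φ) i =
        frame θ φ.toReal (w : R3) i - (!₂[1, 0, 0] : R3) i := by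
      rw [map_sub, e, PiLp.sub_apply]
    refine ⟨?_, ?_⟩
    -- The direction of increasing longitude has no third coordinate, so the projected displacement
    -- bound applies to it.
    · have hb := abs_horizontal_component_le hw (p := -Real.sin φ.toReal) (q := Real.cos φ.toReal)
        (by rw [neg_sq]; exact Real.sin_sq_add_cos_sq _)
      have e1 := hsub 1
      rw [frame_apply_one] at e1
      simp only [PiLp.sub_apply] at e1
      rw [e1] at hb
      have hz : |(point θ φ : R3) 2| ≤ |θ| := by simpa [point] using Real.abs_sin_le_abs
      have : r * (r + |(point θ φ : R3) 2|) ≤ r * (r + |θ|) := by gcongr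
      simpa using hb.trans this
    · have h := PiLp.norm_apply_le (frame θ φ.toReal ((w : R3) - point θ φ)) 2
      rw [LinearIsometry.norm_map, hsub 2, Real.norm_eq_abs] at h
      simpa using h.trans (norm_sub_le_of_subRiemannianDist_lt hw)
  rcases min_choice 1 (r ^ 2 * max r |θ|) with h | h
  · rw [h]
    exact h1.trans (ENNReal.ofReal_le_ofReal (by norm_num))
  · rw [h]
    refine h2.trans (ENNReal.ofReal_le_ofReal ?_)
    have : r + |θ| ≤ 2 * max r |θ| := by linarith [le_max_left r |θ|, le_max_right r |θ|]
    nlinarith [mul_le_mul_of_nonneg_left this (sq_nonneg r)]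

theorem subRiemannianDist_lt_of_frame {θ r : ℝ} (hθ : |θ| ≤ Real.pi / 2) (φ : Real.Angle)
    (hr : 0 < r) (hr1 : r ≤ 1) (w : S2) (h0 : 0 < frame θ φ.toReal (w : R3) 0)
    (h1 : |frame θ φ.toReal (w : R3) 1| ≤ 1 / 1000 * (r * max r |θ|))
    (h2 : |frame θ φ.toReal (w : R3) 2| ≤ 1 / 1000 * r) :
    subRiemannianDist (point θ φ) w < ENNReal.ofReal r := by
  obtain ⟨θ', hθ', φ', rfl⟩ := exists_eq_point w
  have hmax : max r |θ| ≤ 2 := max_le (by linarith) (by linarith [Real.pi_le_four])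
  have hsum := frame_sq_sum θ φ.toReal (point θ' φ' : R3)
  rw [norm_eq_of_mem_sphere, one_pow] at hsum
  set a := frame θ φ.toReal (point θ' φ' : R3) 0 with ha
  set b := frame θ φ.toReal (point θ' φ' : R3) 1 with hb
  set f := frame θ φ.toReal (point θ' φ' : R3) 2 with hf
  have hmax0 : 0 < max r |θ| := lt_max_of_lt_left hr
  have hR : ‖(point θ' φ' : R3) - point θ φ‖ ≤ 1 / 250 * r := by
    have e := frame_sq_sum θ φ.toReal ((point θ' φ' : R3) - point θ φ)
    rw [map_sub, coe_point_eq_chart θ φ, frame_chart] at e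
    simp only [PiLp.sub_apply, ← ha, ← hb, ← hf] at e
    simp at e
    rw [coe_point_eq_chart θ φ]
    refine (abs_le_of_sq_le_sq' ?_ (by positivity)).2
    rw [← e]
    have b1 : |b| ≤ 1 / 500 * r := h1.trans (by nlinarith)
    have b2 : b ^ 2 ≤ (1 / 500 * r) ^ 2 := by rw [← sq_abs]; gcongr
    have f2 : f ^ 2 ≤ (1 / 1000 * r) ^ 2 := by rw [← sq_abs]; gcongr
    have a1 : a ≤ 1 := by nlinarith [sq_nonneg b, sq_nonneg f]
    -- Since `0 < a ≤ 1`, `(a - 1)² ≤ 1 - a² = b² + f²`; positivity of `a` excludes the antipodal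
    -- patch.
    nlinarith
  -- For `|θ| ≥ 1/2` the chord suffices: `70 / 250 < 1`. Near the equator the longitude needs the
  -- finer bound on `b`.
  rcases le_or_gt (1 / 2) |θ| with hbig | hsmall
  · refine (subRiemannianDist_le_norm hθ hθ' φ φ' (ε := 1 / 2) (by norm_num)
      (hbig.trans (le_max_left _ _))).trans_lt ?_
    rw [ENNReal.ofReal_lt_ofReal_iff hr]
    linarith
  obtain ⟨Θ, hh, l1, l2⟩ := exists_larger_latitude θ θ'
  have hΘ : |Θ| ≤ Real.pi / 2 := by rcases hh with rfl | rfl <;> assumption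
  have a1 := abs_latitude_sub_le hθ hθ' φ φ'
  have a2 := cos_mul_dist_le_norm φ φ' hΘ l1 l2
  have hθ'small : |θ'| ≤ 3 / 5 := by
    have := abs_sub_abs_le_abs_sub θ' θ
    rw [abs_sub_comm] at this
    linarith
  have hcos : ∀ u : ℝ, |u| ≤ 3 / 5 → 4 / 5 ≤ Real.cos u := fun u hu => by
    have := Real.one_sub_sq_div_two_le_cos (x := u)
    have h2 : u ^ 2 ≤ (3 / 5) ^ 2 := by rw [← sq_abs]; gcongr
    linarith
  have hcΘ : 4 / 5 ≤ Real.cos Θ := hcos Θ (by rcases hh with rfl | rfl <;> linarith)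
  have hd0 : 0 ≤ dist φ φ' := dist_nonneg
  have hd1 : dist φ φ' ≤ 1 := by nlinarith
  have hbsin : |b| = Real.cos θ' * |Real.sin (dist φ φ')| := by
    have e1 : b = Real.cos θ' * Real.sin (φ'.toReal - φ.toReal) := by
      rw [hb, coe_point_eq_chart, frame_apply_one, Real.sin_sub]
      simp [chart]
      ring
    have e2 : Real.sin (φ'.toReal - φ.toReal) = Real.sin (φ' - φ).toReal := by
      rw [Real.Angle.sin_toReal, ← Real.Angle.sin_coe, Real.Angle.coe_sub, Real.Angle.coe_toReal,
        Real.Angle.coe_toReal]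
    rw [e1, e2, abs_mul, abs_of_nonneg (cos_nonneg_of_abs_le hθ'), dist_eq_abs_toReal]
    rcases abs_choice (φ' - φ).toReal with h | h <;> rw [h]
    rw [Real.sin_neg, abs_neg]
  have hd2 : dist φ φ' ≤ 1 / 400 * (r * max r |θ|) := by
    have h3 := abs_le_two_mul_abs_sin (x := dist φ φ') (by
      rw [abs_of_nonneg hd0]; linarith [Real.pi_gt_three])
    rw [abs_of_nonneg hd0] at h3
    have h4 := mul_le_mul_of_nonneg_right (hcos θ' hθ'small) (abs_nonneg (Real.sin (dist φ φ')))
    rw [← hbsin] at h4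
    linarith
  have hgap : gap |Real.sin Θ| (Real.cos Θ) (dist φ φ') ≤ 1 / 20 * r := by
    rcases le_or_gt |θ| r with h | h
    · rw [max_eq_left h] at hd2
      have : gap |Real.sin Θ| (Real.cos Θ) (dist φ φ') ≤ √(dist φ φ') := by
        unfold gap; split_ifs <;> simp
      refine this.trans (Real.sqrt_le_iff.2 ⟨by positivity, ?_⟩)
      linarith
    · rw [max_eq_right h.le] at hd2
      have hs := (l1.trans (abs_le_two_mul_abs_sin hΘ))
      have hs0 : 0 < |Real.sin Θ| := by linarith
      rw [gap, if_neg hs0.ne']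
      refine (min_le_right _ _).trans ?_
      rw [div_le_iff₀ hs0]
      have := mul_le_of_le_one_right hd0 (Real.cos_le_one Θ)
      have := mul_le_mul_of_nonneg_left hs hr.le
      nlinarith
  refine (subRiemannianDist_le_model hθ hθ' φ φ').trans_lt ?_
  rw [model_eq φ φ' hΘ hh l1 l2, ← ENNReal.ofReal_coe_nnreal, ← ENNReal.ofReal_mul (by simp),
    ENNReal.ofReal_lt_ofReal_iff hr]
  push_cast
  linarith

theorem le_ballVolume_of_le_one {θ : ℝ} (hθ : |θ| ≤ Real.pi / 2) (φ : Real.Angle) {r : ℝ}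
    (hr : 0 < r) (hr1 : r ≤ 1) :
    ENNReal.ofReal (r ^ 2 * max r |θ|) ≤ ENNReal.ofReal 6000000 * ballVolume (point θ φ) r := by
  have hmax : max r |θ| ≤ 2 := max_le (by linarith) (by linarith [Real.pi_le_four])
  have hmax0 : 0 < max r |θ| := lt_max_of_lt_left hr
  have h := le_surfaceMeasure θ φ.toReal (δ := 1 / 1000 * (r * max r |θ|)) (η := 1 / 1000 * r)
    (by positivity) (by positivity) (by nlinarith) (by linarith)
  have hsub : {w : S2 | 0 < frame θ φ.toReal (w : R3) 0 ∧
      |frame θ φ.toReal (w : R3) 1| ≤ 1 / 1000 * (r * max r |θ|) * frame θ φ.toReal (w : R3) 0 ∧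
      |frame θ φ.toReal (w : R3) 2| ≤ 1 / 1000 * r * frame θ φ.toReal (w : R3) 0} ⊆
      {w : S2 | subRiemannianDist (point θ φ) w < ENNReal.ofReal r} := by
    rintro w ⟨h0, h1, h2⟩
    have hw : frame θ φ.toReal (w : R3) 0 ≤ 1 := by
      have h := PiLp.norm_apply_le (frame θ φ.toReal (w : R3)) 0
      rw [LinearIsometry.norm_map, norm_eq_of_mem_sphere] at h
      exact (le_abs_self _).trans h
    exact subRiemannianDist_lt_of_frame hθ φ hr hr1 w h0
      (h1.trans (mul_le_of_le_one_right (by positivity) hw))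
      (h2.trans (mul_le_of_le_one_right (by positivity) hw))
  calc ENNReal.ofReal (r ^ 2 * max r |θ|)
      ≤ ENNReal.ofReal 6000000 *
        ENNReal.ofReal (3 / 16 * (1 / 1000 * (r * max r |θ|) * (1 / 1000 * r))) := by
        rw [← ENNReal.ofReal_mul (by norm_num)]
        refine ENNReal.ofReal_le_ofReal ?_
        have : 0 ≤ r ^ 2 * max r |θ| := by positivity
        linarith
    _ ≤ _ := mul_le_mul_right (h.trans (measure_mono hsub)) _

theorem le_ballVolume {θ : ℝ} (hθ : |θ| ≤ Real.pi / 2) (φ : Real.Angle) {r : ℝ} (hr : 0 < r) :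
    ENNReal.ofReal (min 1 (r ^ 2 * max r |θ|)) ≤
      ENNReal.ofReal 6000000 * ballVolume (point θ φ) r := by
  rcases le_or_gt r 1 with h | h
  · exact (ENNReal.ofReal_le_ofReal (min_le_right _ _)).trans (le_ballVolume_of_le_one hθ φ hr h)
  -- For `r > 1` the ball contains the unit one, whose volume is already bounded below.
  · have h1 := le_ballVolume_of_le_one hθ φ one_pos le_rfl
    refine (ENNReal.ofReal_le_ofReal ?_).trans (h1.trans (mul_le_mul_right (measure_mono ?_) _))
    · exact (min_le_left _ _).trans (by simp)
    · exact fun w hw => lt_of_lt_of_le hw (ENNReal.ofReal_le_ofReal h.le)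

theorem comparable_ballVolume {θ : ℝ} (hθ : |θ| ≤ Real.pi / 2) (φ : Real.Angle) {r : ℝ}
    (hr : 0 ≤ r) :
    Comparable 6000000 (ballVolume (point θ φ) r)
      (ENNReal.ofReal (min 1 (r ^ 2 * max r |θ|))) := by
  have e : ((6000000 : ℝ≥0) : ℝ≥0∞) = ENNReal.ofReal 6000000 := by simp
  rw [Comparable, e]
  rcases hr.eq_or_lt with rfl | hr
  · simp [ballVolume]
  · refine ⟨(ballVolume_le φ hr).trans ?_, le_ballVolume hθ φ hr⟩
    rw [ENNReal.ofReal_mul (by norm_num)]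
    gcongr
    norm_num

end GrushinSphere

end

theorem mainTheorem8 :
    (∃ C : ℝ≥0, 0 < C ∧
      ∀ θ ∈ Icc (-(Real.pi / 2)) (Real.pi / 2), ∀ θ' ∈ Icc (-(Real.pi / 2)) (Real.pi / 2),
      ∀ φ φ' : Real.Angle,
        GrushinSphere.Comparable C
          (GrushinSphere.subRiemannianDist (GrushinSphere.point θ φ) (GrushinSphere.point θ' φ'))
          (GrushinSphere.model θ φ θ' φ')) ∧
    (∃ C : ℝ≥0, 0 < C ∧ ∀ φ φ' : Real.Angle,
        GrushinSphere.Comparable C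
          (GrushinSphere.subRiemannianDist (GrushinSphere.point 0 φ) (GrushinSphere.point 0 φ'))
          (ENNReal.ofReal (dist φ φ' ^ (1 / 2 : ℝ)))) ∧
    (∀ ε : ℝ, 0 < ε → ∃ C : ℝ≥0, 0 < C ∧
      ∀ θ ∈ Icc (-(Real.pi / 2)) (Real.pi / 2), ∀ θ' ∈ Icc (-(Real.pi / 2)) (Real.pi / 2),
      ∀ φ φ' : Real.Angle, ε ≤ max |θ| |θ'| →
        GrushinSphere.Comparable C
          (GrushinSphere.subRiemannianDist (GrushinSphere.point θ φ) (GrushinSphere.point θ' φ'))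
          (GrushinSphere.riemannianDist (GrushinSphere.point θ φ) (GrushinSphere.point θ' φ'))) ∧
    (∃ C : ℝ≥0, 0 < C ∧
      ∀ θ ∈ Icc (-(Real.pi / 2)) (Real.pi / 2), ∀ φ : Real.Angle, ∀ r : ℝ, 0 ≤ r →
        GrushinSphere.Comparable C
          (GrushinSphere.ballVolume (GrushinSphere.point θ φ) r)
          (ENNReal.ofReal (min 1 (r ^ 2 * max r |θ|)))) := by
  refine ⟨⟨7, by norm_num, fun θ hθ θ' hθ' φ φ' => ?_⟩, ⟨7, by norm_num, fun φ φ' => ?_⟩,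
    fun ε hε => ?_, ⟨6000000, by norm_num, fun θ hθ φ r hr => ?_⟩⟩
  · exact GrushinSphere.comparable_model (abs_le.2 hθ) (abs_le.2 hθ') φ φ'
  · have h0 : |(0 : ℝ)| ≤ Real.pi / 2 := by simpa using Real.pi_div_two_pos.le
    rw [← GrushinSphere.model_zero_zero]
    exact GrushinSphere.comparable_model h0 h0 φ φ'
  · obtain ⟨C, hC, h⟩ := GrushinSphere.exists_comparable_riemannianDist hε
    exact ⟨C, hC, fun θ hθ θ' hθ' => h θ θ' (abs_le.2 hθ) (abs_le.2 hθ')⟩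
  · exact GrushinSphere.comparable_ballVolume (abs_le.2 hθ) φ hr
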